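/- Conventions. An almost hypercomplex manifold with Hermitian and Norden metrics $(\overline M,H,G)$ of dimension $4n$ is a smooth manifold with smooth fields of endomorphisms $H=(J_1,J_2,J_3)$ of the tangent bundle satisfying $J_\alpha^2=-I$, $J_\alpha=J_\beta J_\gamma=-J_\gamma J_\beta$ for all cyclic permutations $(\alpha,\beta,\gamma)$ of $(1,2,3)$, and a pseudo-Riemannian metric $g$ with $g(J_1X,J_1Y)=-g(J_2X,J_2Y)=-g(J_3X,J_3Y)=g(X,Y)$. With $\overline\nabla$ the Levi-Civita connection of $g$, put $\overline F_\alpha(X,Y,Z)=g((\overline\nabla_XJ_\alpha)Y,Z)$ and define the Lee forms $\overline\theta_\alpha(Z)=g^{ij}\overline F_\alpha(e_i,e_j,Z)$. It is a $\mathcal W$-manifold if the Nijenhuis tensors of $J_1,J_2,J_3$ vanish and $$\overline F_1(X,Y,Z)=\tfrac1{2(2n-1)}\big[g(X,Y)\overline\theta_1(Z)-g(X,Z)\overline\theta_1(Y)-g(X,J_1Y)\overline\theta_1(J_1Z)+g(X,J_1Z)\overline\theta_1(J_1Y)\big],$$ $$\overline F_\alpha(X,Y,Z)=\tfrac1{4n}\big[g(X,Y)\overline\theta_\alpha(Z)+g(X,Z)\overline\theta_\alpha(Y)+g(X,J_\alpha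 Y)\overline\theta_\alpha(J_\alpha Z)+g(X,J_\alpha Z)\overline\theta_\alpha(J_\alpha Y)\big],\quad\alpha=2,3.$$ A holomorphic submanifold is a (possibly only immersed) submanifold $M$ of dimension $4m$ with $J_\alpha(T_pM)=T_pM$ for all $p\in M$ and $\alpha=1,2,3$, on whose tangent spaces $g$ is non-degenerate; it is a holomorphic $\mathcal W$-submanifold if $M$, with the restrictions of $J_\alpha$ and $g$, is itself a $\mathcal W$-manifold. Let $h(X,Y)=\overline\nabla_XY-\nabla_XY$ be its second fundamental form, where $\nabla$ is the Levi-Civita connection of the restriction of $g$ to $M$, and $C=\frac1{4m}\operatorname{trace}h$ its mean curvature vector. $M$ is totally umbilical if $h(X,Y)=g(X,Y)C$ for all $X,Y\in TM$, and totally geodesic if $h=0$. Statement. Let $0<m<n$ and let $M$ be a $4m$-dimensional holomorphic $\mathcal W$-submanifold of a $4n$-dimensional $\mathcal W$-manifold $(\overline M,H,G)$. (1) If each $\overline\theta_\alpha$ ($\alpha=1,2,3$) is non-zero on $TM^\bot$ (does not vanish identically there), then $M$ is totally umbilical, and $C_p\neq0$ at every point $p\in M$ at which some $\overline\theta_\alpha$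 is non-zero on $T_pM^\bot$; in particular $C$ is not identically zero. (2) If all $\overline\theta_\alpha$ ($\alpha=1,2,3$) vanish on $TM^\bot$, then $M$ is totally geodesic. -/

import Mathlib

open scoped Manifold ContDiff
open Bundle

noncomputable section

namespace HermitianNorden

/-! Manifolds are modelled on a finite-dimensional real normed space `E` (no boundary); the tangent
space at `p` is `TangentSpace 𝓘(ℝ, E) p`. -/

section LinearAlgebra

/-- The metric trace `g^{ij} B(e_i, e_j)` of a vector-valued bilinear form `B` with respect to a
non-degenerate symmetric form `g`, where `(g^{ij})` is the inverse of the Gram matrix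
`(g(e_i, e_j))`. (For bilinear `B` it does not depend on the basis.) -/
def metricTrace {V W : Type*} [AddCommGroup V] [Module ℝ V] [FiniteDimensional ℝ V]
    [AddCommGroup W] [Module ℝ W] (g : V → V → ℝ) (B : V → V → W) : W :=
  ∑ i, ∑ j, (Matrix.of fun k l => g (Module.finBasis ℝ V k) (Module.finBasis ℝ V l))⁻¹ i j •
    B (Module.finBasis ℝ V i) (Module.finBasis ℝ V j)

end LinearAlgebra

section Metric

variable (E : Type*) [NormedAddCommGroup E] [NormedSpace ℝ E]
  (M : Type*) [TopologicalSpace M] [ChartedSpace E M] [IsManifold 𝓘(ℝ, E) ∞ M]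

/-- A smooth pseudo-Riemannian metric. -/
structure PseudoRiemannianMetric where
  /-- the scalar product on each tangent space -/
  val : ∀ p : M, TangentSpace 𝓘(ℝ, E) p →L[ℝ] TangentSpace 𝓘(ℝ, E) p →L[ℝ] ℝ
  symm : ∀ p u v, val p u v = val p v u
  nondegenerate : ∀ p u, (∀ v, val p u v = 0) → u = 0
  contMDiff : ContMDiff 𝓘(ℝ, E) (𝓘(ℝ, E).prod 𝓘(ℝ, E →L[ℝ] E →L[ℝ] ℝ)) ∞
    (fun p : M => TotalSpace.mk' (E →L[ℝ] E →L[ℝ] ℝ)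
      (E := fun q : M => TangentSpace 𝓘(ℝ, E) q →L[ℝ] TangentSpace 𝓘(ℝ, E) q →L[ℝ] ℝ) p (val p))

end Metric

section Connection

variable {E : Type*} [NormedAddCommGroup E] [NormedSpace ℝ E] [FiniteDimensional ℝ E]
  {M : Type*} [TopologicalSpace M] [ChartedSpace E M] [IsManifold 𝓘(ℝ, E) ∞ M]

/-- The local vector field with constant components `v` in the preferred chart at `p`;
its value at `p` is `v`. -/
def coordField (p : M) (v : E) (y : M) : TangentSpace 𝓘(ℝ, E) y :=
  (trivializationAt E (TangentSpace 𝓘(ℝ, E)) p).symmL ℝ y v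

/-- The components, in the preferred chart at `p`, of a tangent vector `v` at `y`
(`y` in the domain of that chart). -/
def components (p y : M) (v : TangentSpace 𝓘(ℝ, E) y) : E :=
  (trivializationAt E (TangentSpace 𝓘(ℝ, E)) p).continuousLinearMapAt ℝ y v

namespace PseudoRiemannianMetric

variable (g : PseudoRiemannianMetric E M)

/-- The components `g_{ij}(y)` of the metric in the preferred chart at `p`, as a bilinear form. -/
def localForm (p y : M) : E →L[ℝ] E →L[ℝ] ℝ :=
  let gy : E →L[ℝ] E →L[ℝ] ℝ := g.val y
  let ι : E →L[ℝ] E := (trivializationAt E (TangentSpace 𝓘(ℝ, E)) p).symmL ℝ y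
  gy.bilinearComp ι ι

/-- The partial derivatives at `p` of the components of the metric in the preferred chart at `p`:
`u, v, w ↦ u^k v^i w^j ∂_k g_{ij}(p)`. -/
def dForm (p : M) : E →L[ℝ] E →L[ℝ] E →L[ℝ] ℝ :=
  mfderiv 𝓘(ℝ, E) 𝓘(ℝ, E →L[ℝ] E →L[ℝ] ℝ) (g.localForm p) p

/-- The metric at `p` as a linear isomorphism of the tangent space onto its dual. -/
def flat (p : M) : E ≃ₗ[ℝ] Module.Dual ℝ E :=
  let gp : E →L[ℝ] E →L[ℝ] ℝ := g.val p
  LinearEquiv.ofInjectiveOfFinrankEq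
    ((ContinuousLinearMap.coeLM ℝ : (E →L[ℝ] ℝ) →ₗ[ℝ] (E →ₗ[ℝ] ℝ)) ∘ₗ
      (gp : E →ₗ[ℝ] E →L[ℝ] ℝ))
    ((injective_iff_map_eq_zero _).2 fun u hu =>
      g.nondegenerate p u fun v => LinearMap.congr_fun hu v)
    Subspace.dual_finrank_eq.symm

/-- The Christoffel symbols of the Levi-Civita connection at `p` in the preferred chart at `p`:
`Γ(u, v)` is the vector with
`2 g(Γ(u, v), w) = u^i v^j w^k (∂_i g_{jk} + ∂_j g_{ik} - ∂_k g_{ij})` for all `w`. -/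
def christoffel (p : M) (u v : E) : E :=
  (g.flat p).symm ((1 / 2 : ℝ) •
    ((g.dForm p u v + g.dForm p v u - ((g.dForm p).flip u).flip v : E →L[ℝ] ℝ) : E →ₗ[ℝ] ℝ))

/-- The Levi-Civita connection: `(∇_u Y)(p)`, for a vector field `Y` and `u` tangent at `p`;
in the chart at `p` this is `u^i ∂_i Y + Γ(u, Y)`. -/
def nabla (Y : ∀ y : M, TangentSpace 𝓘(ℝ, E) y) (p : M) (u : TangentSpace 𝓘(ℝ, E) p) :
    TangentSpace 𝓘(ℝ, E) p :=
  let DY : E →L[ℝ] E := mfderiv 𝓘(ℝ, E) 𝓘(ℝ, E) (fun y : M => components p y (Y y)) p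
  DY u + g.christoffel p u (Y p)

/-- `(∇_u J) v = ∇_u (J V) - J (∇_u V)` at `p`, for a field `J` of endomorphisms of the tangent
bundle; `V` is the local extension of `v` constant in the chart at `p`. -/
def nablaEnd (J : ∀ y : M, TangentSpace 𝓘(ℝ, E) y →L[ℝ] TangentSpace 𝓘(ℝ, E) y) (p : M)
    (u v : TangentSpace 𝓘(ℝ, E) p) : TangentSpace 𝓘(ℝ, E) p :=
  g.nabla (fun y => J y (coordField (E := E) p v y)) p u - J p (g.nabla (coordField (E := E) p v) p u)

/-- The Levi-Civita connection along a map `f : N → M`: the covariant derivative at `p : N`, in the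
direction `u` tangent to `N`, of a vector field `W` of `M` along `f`. (This is `∇_u W` for vector
fields `W` of `M` given along a submanifold `N` only.) -/
def nablaAlong {E' : Type*} [NormedAddCommGroup E'] [NormedSpace ℝ E']
    {N : Type*} [TopologicalSpace N] [ChartedSpace E' N]
    (f : N → M) (W : ∀ y : N, TangentSpace 𝓘(ℝ, E) (f y)) (p : N)
    (u : TangentSpace 𝓘(ℝ, E') p) : TangentSpace 𝓘(ℝ, E) (f p) :=
  let DW : E' →L[ℝ] E :=
    mfderiv 𝓘(ℝ, E') 𝓘(ℝ, E) (fun y : N => components (f p) (f y) (W y)) p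
  DW u + g.christoffel (f p) (mfderiv 𝓘(ℝ, E') 𝓘(ℝ, E) f p u) (W p)

end PseudoRiemannianMetric

/-- Integrability of a field of endomorphisms `J` with `J² = -1`: the Nijenhuis tensor
`[JX, JY] - J[JX, Y] - J[X, JY] - [X, Y]` vanishes for all smooth vector fields `X`, `Y`. -/
def NijenhuisVanishes
    (J : ∀ y : M, TangentSpace 𝓘(ℝ, E) y →L[ℝ] TangentSpace 𝓘(ℝ, E) y) : Prop :=
  ∀ X Y : ∀ y : M, TangentSpace 𝓘(ℝ, E) y,
    ContMDiff 𝓘(ℝ, E) 𝓘(ℝ, E).tangent ∞ (fun y => (⟨y, X y⟩ : TangentBundle 𝓘(ℝ, E) M)) →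
    ContMDiff 𝓘(ℝ, E) 𝓘(ℝ, E).tangent ∞ (fun y => (⟨y, Y y⟩ : TangentBundle 𝓘(ℝ, E) M)) →
    ∀ p : M,
      VectorField.mlieBracket 𝓘(ℝ, E) (fun y => J y (X y)) (fun y => J y (Y y)) p
        - J p (VectorField.mlieBracket 𝓘(ℝ, E) (fun y => J y (X y)) Y p)
        - J p (VectorField.mlieBracket 𝓘(ℝ, E) X (fun y => J y (Y y)) p)
        - VectorField.mlieBracket 𝓘(ℝ, E) X Y p = 0

end Connection

section Structure

/-- An almost hypercomplex structure with Hermitian and Norden metrics on `M`: three smooth fields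
of endomorphisms `J_1, J_2, J_3` (here `J 0, J 1, J 2`) and a pseudo-Riemannian metric `g`. The
associated forms `g_α(X, Y) = g(J_α X, Y)` are determined by these. -/
structure HNStructure (E : Type*) [NormedAddCommGroup E] [NormedSpace ℝ E]
    (M : Type*) [TopologicalSpace M] [ChartedSpace E M] [IsManifold 𝓘(ℝ, E) ∞ M] where
  /-- the almost complex structures -/
  J : Fin 3 → ∀ p : M, TangentSpace 𝓘(ℝ, E) p →L[ℝ] TangentSpace 𝓘(ℝ, E) p
  /-- the metric -/
  g : PseudoRiemannianMetric E M
  contMDiff_J : ∀ α, ContMDiff 𝓘(ℝ, E) (𝓘(ℝ, E).prod 𝓘(ℝ, E →L[ℝ] E)) ∞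
    (fun p : M => TotalSpace.mk' (E →L[ℝ] E)
      (E := fun q : M => TangentSpace 𝓘(ℝ, E) q →L[ℝ] TangentSpace 𝓘(ℝ, E) q) p (J α p))
  J_sq : ∀ α p v, J α p (J α p v) = -v
  /-- `J_α = J_β J_γ` for the cyclic permutations `(α, β, γ)` of `(1, 2, 3)` -/
  J_cyclic : ∀ α p v, J α p v = J (α + 1) p (J (α + 2) p v)
  /-- `J_α = -J_γ J_β` for the cyclic permutations `(α, β, γ)` of `(1, 2, 3)` -/
  J_cyclic' : ∀ α p v, J α p v = -J (α + 2) p (J (α + 1) p v)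
  /-- `g` is Hermitian for `J_1` -/
  hermitian : ∀ p u v, g.val p (J 0 p u) (J 0 p v) = g.val p u v
  /-- `g` is a Norden metric for `J_2` -/
  norden_two : ∀ p u v, g.val p (J 1 p u) (J 1 p v) = -g.val p u v
  /-- `g` is a Norden metric for `J_3` -/
  norden_three : ∀ p u v, g.val p (J 2 p u) (J 2 p v) = -g.val p u v

namespace HNStructure

variable {E : Type*} [NormedAddCommGroup E] [NormedSpace ℝ E] [FiniteDimensional ℝ E]
  {M : Type*} [TopologicalSpace M] [ChartedSpace E M] [IsManifold 𝓘(ℝ, E) ∞ M]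

/-- The fundamental tensors `F_α(X, Y, Z) = g((∇_X J_α) Y, Z)`. -/
def F (S : HNStructure E M) (α : Fin 3) (p : M) (X Y Z : TangentSpace 𝓘(ℝ, E) p) : ℝ :=
  S.g.val p (S.g.nablaEnd (S.J α) p X Y) Z

/-- The Lee forms `θ_α(Z) = g^{ij} F_α(e_i, e_j, Z)`. -/
def leeForm (S : HNStructure E M) (α : Fin 3) (p : M) (Z : TangentSpace 𝓘(ℝ, E) p) : ℝ :=
  metricTrace (V := E) (fun X Y => S.g.val p X Y) (fun X Y => S.F α p X Y Z)

/-- `M` with `S` is a `W`-manifold of dimension `4n`: `J_1, J_2, J_3` are integrable, `F_1` has the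
form characterizing locally conformally Kähler structures, and `F_2`, `F_3` have the form
characterizing locally conformally Kähler–Norden structures. -/
structure IsWManifold (S : HNStructure E M) (n : ℕ) : Prop where
  integrable : ∀ α, NijenhuisVanishes (S.J α)
  F_one : ∀ p X Y Z, S.F 0 p X Y Z = 1 / (2 * (2 * (n : ℝ) - 1)) *
    (S.g.val p X Y * S.leeForm 0 p Z - S.g.val p X Z * S.leeForm 0 p Y
      - S.g.val p X (S.J 0 p Y) * S.leeForm 0 p (S.J 0 p Z)
      + S.g.val p X (S.J 0 p Z) * S.leeForm 0 p (S.J 0 p Y))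
  F_two_three : ∀ α, α = 1 ∨ α = 2 → ∀ p X Y Z, S.F α p X Y Z = 1 / (4 * (n : ℝ)) *
    (S.g.val p X Y * S.leeForm α p Z + S.g.val p X Z * S.leeForm α p Y
      + S.g.val p X (S.J α p Y) * S.leeForm α p (S.J α p Z)
      + S.g.val p X (S.J α p Z) * S.leeForm α p (S.J α p Y))

end HNStructure

end Structure

section Submanifold

variable {E : Type*} [NormedAddCommGroup E] [NormedSpace ℝ E] [FiniteDimensional ℝ E]
  {M : Type*} [TopologicalSpace M] [ChartedSpace E M] [IsManifold 𝓘(ℝ, E) ∞ M]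
  {E' : Type*} [NormedAddCommGroup E'] [NormedSpace ℝ E'] [FiniteDimensional ℝ E']
  {M' : Type*} [TopologicalSpace M'] [ChartedSpace E' M'] [IsManifold 𝓘(ℝ, E') ∞ M']

/-- The immersion `f : M → M'` makes `M` a holomorphic submanifold of `(M', S')`: the tangent spaces
of `M` are preserved by the `J_α`, and the metric restricts to a non-degenerate form on them. -/
structure IsHolomorphicSubmanifold (f : M → M') (S' : HNStructure E' M') : Prop where
  contMDiff : ContMDiff 𝓘(ℝ, E) 𝓘(ℝ, E') ∞ f
  immersion : ∀ p : M, Function.Injective (mfderiv 𝓘(ℝ, E) 𝓘(ℝ, E') f p)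
  map_J : ∀ (α : Fin 3) (p : M),
    S'.J α (f p) '' Set.range (mfderiv 𝓘(ℝ, E) 𝓘(ℝ, E') f p)
      = Set.range (mfderiv 𝓘(ℝ, E) 𝓘(ℝ, E') f p)
  nondegenerate : ∀ (p : M) (u : TangentSpace 𝓘(ℝ, E) p),
    (∀ v : TangentSpace 𝓘(ℝ, E) p, S'.g.val (f p) (mfderiv 𝓘(ℝ, E) 𝓘(ℝ, E') f p u)
      (mfderiv 𝓘(ℝ, E) 𝓘(ℝ, E') f p v) = 0) → u = 0

/-- `S` is the restriction to `M` of the structure `S'` of the ambient manifold: its metric and its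
endomorphisms are those of `S'` on the tangent spaces of `M`. (This determines `S`.) -/
structure IsRestriction (f : M → M') (S : HNStructure E M) (S' : HNStructure E' M') : Prop where
  g_eq : ∀ (p : M) (u v : TangentSpace 𝓘(ℝ, E) p),
    S.g.val p u v = S'.g.val (f p) (mfderiv 𝓘(ℝ, E) 𝓘(ℝ, E') f p u)
      (mfderiv 𝓘(ℝ, E) 𝓘(ℝ, E') f p v)
  J_eq : ∀ (α : Fin 3) (p : M) (u : TangentSpace 𝓘(ℝ, E) p),
    mfderiv 𝓘(ℝ, E) 𝓘(ℝ, E') f p (S.J α p u)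
      = S'.J α (f p) (mfderiv 𝓘(ℝ, E) 𝓘(ℝ, E') f p u)

/-- The normal space `T_pM^⊥`. -/
def normalSpace (f : M → M') (g' : PseudoRiemannianMetric E' M') (p : M) :
    Set (TangentSpace 𝓘(ℝ, E') (f p)) :=
  {N | ∀ u : TangentSpace 𝓘(ℝ, E) p, g'.val (f p) N (mfderiv 𝓘(ℝ, E) 𝓘(ℝ, E') f p u) = 0}

/-- The second fundamental form `h(u, v) = ∇'_u V - ∇_u V` at `p` (Gauss formula), where `∇'` and
`∇` are the Levi-Civita connections of the ambient manifold and of `M`, tangent vectors of `M` are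
mapped into the ambient tangent spaces by the differential of `f`, and `V` is the local extension
of `v` to a vector field on `M` with constant components in the chart at `p`. -/
def secondFundamentalForm (f : M → M') (g : PseudoRiemannianMetric E M)
    (g' : PseudoRiemannianMetric E' M') (p : M) (u v : TangentSpace 𝓘(ℝ, E) p) :
    TangentSpace 𝓘(ℝ, E') (f p) :=
  g'.nablaAlong f (fun y => mfderiv 𝓘(ℝ, E) 𝓘(ℝ, E') f y (coordField (E := E) p v y)) p u
    - mfderiv 𝓘(ℝ, E) 𝓘(ℝ, E') f p (g.nabla (coordField (E := E) p v) p u)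

/-- The mean curvature vector `C = (1 / dim M) trace h`. -/
def meanCurvature (f : M → M') (g : PseudoRiemannianMetric E M)
    (g' : PseudoRiemannianMetric E' M') (p : M) : TangentSpace 𝓘(ℝ, E') (f p) :=
  (1 / (Module.finrank ℝ E : ℝ)) • metricTrace (V := E) (fun u v => g.val p u v)
    (fun u v => secondFundamentalForm f g g' p u v)

/-- `h(X, Y) = g(X, Y) C`. -/
def IsTotallyUmbilical (f : M → M') (g : PseudoRiemannianMetric E M)
    (g' : PseudoRiemannianMetric E' M') : Prop :=
  ∀ (p : M) (u v : TangentSpace 𝓘(ℝ, E) p),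
    secondFundamentalForm f g g' p u v = g.val p u v • meanCurvature f g g' p

/-- `h = 0`. -/
def IsTotallyGeodesic (f : M → M') (g : PseudoRiemannianMetric E M)
    (g' : PseudoRiemannianMetric E' M') : Prop :=
  ∀ (p : M) (u v : TangentSpace 𝓘(ℝ, E) p), secondFundamentalForm f g g' p u v = 0

end Submanifold

end HermitianNorden

end

noncomputable section

namespace HermitianNorden

/-! ### Coordinate expressions at a point and symmetry of the second derivative -/

section Local
variable {E : Type*} [NormedAddCommGroup E] [NormedSpace ℝ E]
  {M : Type*} [TopologicalSpace M] [ChartedSpace E M] [IsManifold 𝓘(ℝ, E) ∞ M]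
  {E' : Type*} [NormedAddCommGroup E'] [NormedSpace ℝ E']
  {M' : Type*} [TopologicalSpace M'] [ChartedSpace E' M'] [IsManifold 𝓘(ℝ, E') ∞ M']

/-! For `X`, `Y` tangent and `N` normal to `M`, write `b_N(X, Y) = g(h(X, Y), N)`. By the Gauss
formula, `(∇'_X J_α) Y` is `h(X, J_α Y) - J_α h(X, Y)` up to a tangent vector. Since `J_1` is skew
and `J_2`, `J_3` are self-adjoint for `g`, the formulas for the ambient `F_α` become relations
between `b_N(X, J_α Y)` and `b_{J_α N}(X, Y)`, with error terms in `g` and `θ_α`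
(`second_commutation_zero`, `second_commutation_norden`).

The rest is algebra. Using each relation at `N` and at `J_α N`, together with the symmetry of `h`,
gives `b_N(J_α X, J_α Y) = -b_N(X, Y)` for `α = 2, 3`, but `-b_N(X, Y)` minus a multiple of `θ_1(J_1
N) g(X, Y)` for `α = 1`. As `J_1 = J_2 J_3`, the first two give `b_N(J_1 X, J_1 Y) = b_N(X, Y)`, so
`b_N` is a multiple of `g` (`conformal_of_commutation`). Since `h` is normal, this is umbilicity,
whatever the Lee forms are.

Substituting back, the factor is also `θ_α(J_α N) / (4n)` for `α = 2, 3` (`conformal_factor_eq`).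
Hence `g(C, N) = k_α θ_α(J_α N)` with `k_α ≠ 0` for each `α`. The `J_α` preserve the normal space
and `g` is non-degenerate there, so `C_p = 0` exactly when any one of the Lee forms vanishes on
`T_pM^⊥`.

The geometry takes place at one point in the preferred charts. The `model...` definitions and `form`
regard tangent-space objects as objects on `E` and `E'`, where linear algebra applies directly. -/

theorem symmL_tangent_self (p : M) (v : E) :
    ((trivializationAt E (TangentSpace 𝓘(ℝ, E)) p).symmL ℝ p v : E) = v := by
  rw [TangentBundle.symmL_trivializationAt_eq_core (mem_chart_source E p)]
  exact (tangentBundleCore 𝓘(ℝ, E) M).coordChange_self _ _ (mem_chart_source E p) v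

theorem continuousLinearMapAt_tangent_self (p : M) (v : E) :
    ((trivializationAt E (TangentSpace 𝓘(ℝ, E)) p).continuousLinearMapAt ℝ p v : E) = v := by
  rw [TangentBundle.continuousLinearMapAt_trivializationAt_eq_core (mem_chart_source E p)]
  exact (tangentBundleCore 𝓘(ℝ, E) M).coordChange_self _ _ (mem_chart_source E p) v

/-- The differential of `f` in the preferred charts at `p` and `f p`. -/
def localDeriv (f : M → M') (p y : M) : E →L[ℝ] E' :=
  inTangentCoordinates 𝓘(ℝ, E) 𝓘(ℝ, E') id f (fun y => mfderiv 𝓘(ℝ, E) 𝓘(ℝ, E') f y) p y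

/-- The components of a field of endomorphisms in the preferred chart at `p`. -/
def localEnd (J : ∀ y : M, TangentSpace 𝓘(ℝ, E) y →L[ℝ] TangentSpace 𝓘(ℝ, E) y) (p y : M) :
    E →L[ℝ] E :=
  inTangentCoordinates 𝓘(ℝ, E) 𝓘(ℝ, E) id id J p y

theorem localDeriv_apply (f : M → M') (p y : M) (v : E) :
    localDeriv (E := E) (E' := E') f p y v
      = components (E := E') (f p) (f y)
          (mfderiv 𝓘(ℝ, E) 𝓘(ℝ, E') f y (coordField (E := E) p v y)) := rfl

theorem localEnd_apply (J : ∀ y : M, TangentSpace 𝓘(ℝ, E) y →L[ℝ] TangentSpace 𝓘(ℝ, E) y)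
    (p y : M) (v : E) :
    localEnd J p y v = components p y (J y (coordField p v y)) := rfl

/-- The differential of `f` at `p` as a map of model spaces. -/
def modelDeriv (f : M → M') (p : M) : E →L[ℝ] E' := mfderiv 𝓘(ℝ, E) 𝓘(ℝ, E') f p

/-- The value at `p` of a field of endomorphisms as an endomorphism of the model space. -/
def modelEnd (J : ∀ y : M, TangentSpace 𝓘(ℝ, E) y →L[ℝ] TangentSpace 𝓘(ℝ, E) y) (p : M) :
    E →L[ℝ] E := J p

theorem localDeriv_self (f : M → M') (p : M) :
    localDeriv (E := E) (E' := E') f p p = modelDeriv (E := E) (E' := E') f p := by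
  ext v
  rw [localDeriv_apply]
  exact (continuousLinearMapAt_tangent_self (E := E') (f p) _).trans
    (congrArg (modelDeriv (E := E) (E' := E') f p) (symmL_tangent_self p v))

theorem localEnd_self (J : ∀ y : M, TangentSpace 𝓘(ℝ, E) y →L[ℝ] TangentSpace 𝓘(ℝ, E) y)
    (p : M) : localEnd J p p = modelEnd J p := by
  ext v
  rw [localEnd_apply]
  exact (continuousLinearMapAt_tangent_self _ _).trans
    (congrArg (modelEnd J p) (symmL_tangent_self p v))

theorem coordField_components {p y : M} (hy : y ∈ (chartAt E p).source)
    (v : TangentSpace 𝓘(ℝ, E) y) : coordField (E := E) p (components p y v) y = v :=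
  (trivializationAt E (TangentSpace 𝓘(ℝ, E)) p).symmL_continuousLinearMapAt (by simpa using hy) v

theorem components_coordField {p y : M} (hy : y ∈ (chartAt E p).source) (v : E) :
    components p y (coordField (E := E) p v y) = v :=
  (trivializationAt E (TangentSpace 𝓘(ℝ, E)) p).continuousLinearMapAt_symmL (by simpa using hy) v

theorem mdifferentiableAt_localDeriv {f : M → M'} {p : M}
    (hf : ContMDiffAt 𝓘(ℝ, E) 𝓘(ℝ, E') ∞ f p) :
    MDifferentiableAt 𝓘(ℝ, E) 𝓘(ℝ, E →L[ℝ] E') (localDeriv (E := E) (E' := E') f p) p :=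
  (hf.mfderiv_const (m := 1) (by norm_cast)).mdifferentiableAt one_ne_zero

theorem mdifferentiableAt_localEnd
    {J : ∀ y : M, TangentSpace 𝓘(ℝ, E) y →L[ℝ] TangentSpace 𝓘(ℝ, E) y} {p : M}
    (hJ : ContMDiffAt 𝓘(ℝ, E) (𝓘(ℝ, E).prod 𝓘(ℝ, E →L[ℝ] E)) ∞
      (fun p : M => TotalSpace.mk' (E →L[ℝ] E)
        (E := fun q : M => TangentSpace 𝓘(ℝ, E) q →L[ℝ] TangentSpace 𝓘(ℝ, E) q) p (J p)) p) :
    MDifferentiableAt 𝓘(ℝ, E) 𝓘(ℝ, E →L[ℝ] E) (localEnd J p) p :=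
  ((contMDiffAt_hom_bundle _).1 hJ).2.mdifferentiableAt (by simp)

theorem PseudoRiemannianMetric.localForm_apply (g : PseudoRiemannianMetric E M) (p y : M)
    (u v : E) :
    g.localForm p y u v
      = g.val y (coordField (E := E) p u y) (coordField (E := E) p v y) :=
  ContinuousLinearMap.bilinearComp_apply (E := E) (F := E) (G := ℝ) (E' := E) (F' := E)
    (g.val y : E →L[ℝ] E →L[ℝ] ℝ) _ _ u v

/-- Smoothness of a section of the bundle of bilinear forms is smoothness of its coordinate
expression, which is matched with `localForm` on the chart domain; agreement near `p` suffices. -/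
theorem PseudoRiemannianMetric.mdifferentiableAt_localForm (g : PseudoRiemannianMetric E M)
    (p : M) : MDifferentiableAt 𝓘(ℝ, E) 𝓘(ℝ, E →L[ℝ] E →L[ℝ] ℝ) (g.localForm p) p := by
  have h := ((contMDiffAt_hom_bundle (F₁ := E) (E₁ := fun q : M => TangentSpace 𝓘(ℝ, E) q)
    (F₂ := E →L[ℝ] ℝ) (E₂ := fun q : M => TangentSpace 𝓘(ℝ, E) q →L[ℝ] ℝ) _).1
    (g.contMDiff p)).2.mdifferentiableAt (by simp)
  refine h.congr_of_eventuallyEq ?_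
  filter_upwards [(chartAt E p).open_source.mem_nhds (mem_chart_source E p)] with y hy
  ext u v
  have := inCoordinates_apply_eq₂ (𝕜 := ℝ) (F₁ := E) (E₁ := fun q : M => TangentSpace 𝓘(ℝ, E) q)
    (F₂ := E) (E₂ := fun q : M => TangentSpace 𝓘(ℝ, E) q) (F₃ := ℝ) (E₃ := fun q : M => ℝ)
    (x₀ := p) (x := y) (ϕ := g.val y) (v := u) (w := v)
    (by simpa using hy) (by simpa using hy) (by simp)
  refine Eq.trans ?_ this.symm
  refine Eq.trans ?_ (LinearMap.congr_fun
    (Trivial.linearMapAt_trivialization (𝕜 := ℝ) (B := M) (F := ℝ) y) _).symm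
  have hs : ∀ w : E, coordField (E := E) p w y
      = (trivializationAt E (fun q : M => TangentSpace 𝓘(ℝ, E) q) p).symm y w := fun w =>
    Trivialization.symmL_apply (R := ℝ) _ (by simpa using hy) w
  rw [LinearMap.id_apply, ← hs, ← hs]
  exact g.localForm_apply p y u v

/-- The derivative at `p` of a function with values in a vector space. -/
def vderiv {F : Type*} [NormedAddCommGroup F] [NormedSpace ℝ F] (G : M → F) (p : M) : E →L[ℝ] F :=
  mfderiv 𝓘(ℝ, E) 𝓘(ℝ, F) G p

section
variable {F : Type*} [NormedAddCommGroup F] [NormedSpace ℝ F]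

omit [IsManifold 𝓘(ℝ, E) ∞ M] in
theorem hasFDerivAt_vderiv {G : M → F} {p : M} (hG : MDifferentiableAt 𝓘(ℝ, E) 𝓘(ℝ, F) G p) :
    HasFDerivAt (G ∘ (extChartAt 𝓘(ℝ, E) p).symm) (vderiv (E := E) G p)
      (extChartAt 𝓘(ℝ, E) p p) := by
  have := hG.hasMFDerivAt.2
  simp only [modelWithCornersSelf_coe, Set.range_id] at this
  exact hasFDerivWithinAt_univ.1 this

omit [IsManifold 𝓘(ℝ, E) ∞ M] in
theorem vderiv_eq_of_hasFDerivAt {G : M → F} {p : M}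
    (hG : MDifferentiableAt 𝓘(ℝ, E) 𝓘(ℝ, F) G p) {L : E →L[ℝ] F}
    (h : HasFDerivAt (G ∘ (extChartAt 𝓘(ℝ, E) p).symm) L (extChartAt 𝓘(ℝ, E) p p)) :
    vderiv (E := E) G p = L :=
  (hasFDerivAt_vderiv hG).unique h

omit [IsManifold 𝓘(ℝ, E) ∞ M] in
theorem vderiv_congr {G G₁ : M → F} {p : M} (h : G =ᶠ[nhds p] G₁) :
    vderiv (E := E) G p = vderiv G₁ p :=
  h.mfderiv_eq

omit [IsManifold 𝓘(ℝ, E) ∞ M] [IsManifold 𝓘(ℝ, E') ∞ M'] in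
theorem vderiv_comp {f : M → M'} {p : M} {G : M' → F}
    (hG : MDifferentiableAt 𝓘(ℝ, E') 𝓘(ℝ, F) G (f p))
    (hf : MDifferentiableAt 𝓘(ℝ, E) 𝓘(ℝ, E') f p) :
    vderiv (E := E) (G ∘ f) p = (vderiv (E := E') G (f p)).comp (modelDeriv (E := E) (E' := E') f p) := 
  mfderiv_comp p hG hf

end

/-- Near `p`, `localDeriv f p` is the Fréchet derivative of `f` read in charts, so its derivative is
a second derivative. The symmetry of `h` rests on this. -/
theorem vderiv_localDeriv_symm {f : M → M'} (hf : ContMDiff 𝓘(ℝ, E) 𝓘(ℝ, E') ∞ f) (p : M)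
    (u v : E) :
    vderiv (E := E) (localDeriv (E := E) (E' := E') f p) p u v = vderiv (E := E) (localDeriv (E := E) (E' := E') f p) p v u := by
  set φ : E → E' := writtenInExtChartAt 𝓘(ℝ, E) 𝓘(ℝ, E') p f with hφ
  set x₀ : E := extChartAt 𝓘(ℝ, E) p p
  have hφs : ContDiffAt ℝ ∞ φ x₀ := by
    have := (contMDiffAt_iff.1 (hf p)).2
    simpa [contDiffWithinAt_univ, hφ, writtenInExtChartAt, x₀] using this
  have key : (localDeriv (E := E) (E' := E') f p ∘ (extChartAt 𝓘(ℝ, E) p).symm) =ᶠ[nhds x₀] fderiv ℝ φ := by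
    have h1 : ∀ᶠ x in nhds x₀, x ∈ (extChartAt 𝓘(ℝ, E) p).target :=
      extChartAt_target_mem_nhds p
    have h2 : ∀ᶠ x in nhds x₀, f ((extChartAt 𝓘(ℝ, E) p).symm x) ∈ (chartAt E' (f p)).source := by
      have hc : ContinuousAt (fun x => f ((extChartAt 𝓘(ℝ, E) p).symm x)) x₀ :=
        (hf.continuous.continuousAt).comp (continuousAt_extChartAt_symm p)
      refine hc.preimage_mem_nhds ((chartAt E' (f p)).open_source.mem_nhds ?_)
      simp [x₀]
    filter_upwards [h1, h2] with x hx hfx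
    set y := (extChartAt 𝓘(ℝ, E) p).symm x with hy
    have hys : y ∈ (extChartAt 𝓘(ℝ, E) p).source := (extChartAt 𝓘(ℝ, E) p).map_target hx
    have hyx : extChartAt 𝓘(ℝ, E) p y = x := (extChartAt 𝓘(ℝ, E) p).right_inv hx
    have e1 : MDifferentiableAt 𝓘(ℝ, E) 𝓘(ℝ, E) (extChartAt 𝓘(ℝ, E) p).symm x := by
      have := mdifferentiableWithinAt_extChartAt_symm hx
      simpa [mdifferentiableWithinAt_univ] using this
    have e2 : MDifferentiableAt 𝓘(ℝ, E) 𝓘(ℝ, E') f y := (hf y).mdifferentiableAt (by simp)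
    have e3 : MDifferentiableAt 𝓘(ℝ, E') 𝓘(ℝ, E') (extChartAt 𝓘(ℝ, E') (f p)) (f y) :=
      mdifferentiableAt_extChartAt hfx
    have e4 := (e3.hasMFDerivAt.comp x (e2.hasMFDerivAt.comp x e1.hasMFDerivAt))
    have e5 : HasFDerivAt φ
        ((mfderiv 𝓘(ℝ, E') 𝓘(ℝ, E') (extChartAt 𝓘(ℝ, E') (f p)) (f y) : E' →L[ℝ] E').comp
          ((mfderiv 𝓘(ℝ, E) 𝓘(ℝ, E') f y : E →L[ℝ] E').comp
            (mfderiv 𝓘(ℝ, E) 𝓘(ℝ, E) (extChartAt 𝓘(ℝ, E) p).symm x : E →L[ℝ] E))) x := by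
      have := e4.2
      simp only [modelWithCornersSelf_coe, Set.range_id] at this
      exact hasFDerivWithinAt_univ.1 this
    have e6 := inTangentCoordinates_eq_mfderiv_comp (I := 𝓘(ℝ, E)) (I' := 𝓘(ℝ, E')) (f := id)
      (g := f) (ϕ := fun y => mfderiv 𝓘(ℝ, E) 𝓘(ℝ, E') f y) (x₀ := p) (x := y)
      (by simpa using hys) hfx
    have e7 := HasFDerivAt.fderiv (𝕜 := ℝ) (E := E) (F := E') e5
    refine Eq.trans ?_ e7.symm
    refine e6.trans ?_
    simp only [modelWithCornersSelf_coe, Set.range_id, mfderivWithin_univ, id]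
    -- The type of `mfderiv` depends on the base point, so the point is replaced by substitution,
    -- after ascription to `E →L[ℝ] E`.
    have e8 : ∀ x', x' = x →
        (mfderiv 𝓘(ℝ, E) 𝓘(ℝ, E) (extChartAt 𝓘(ℝ, E) p).symm x' : E →L[ℝ] E)
          = mfderiv 𝓘(ℝ, E) 𝓘(ℝ, E) (extChartAt 𝓘(ℝ, E) p).symm x := by
      rintro _ rfl; rfl
    exact congrArg (fun L : E →L[ℝ] E =>
      (mfderiv 𝓘(ℝ, E') 𝓘(ℝ, E') (extChartAt 𝓘(ℝ, E') (f p)) (f y) : E' →L[ℝ] E').comp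
          ((mfderiv 𝓘(ℝ, E) 𝓘(ℝ, E') f y : E →L[ℝ] E').comp L)) (e8 _ hyx)
  have hd : vderiv (E := E) (localDeriv (E := E) (E' := E') f p) p = fderiv ℝ (fderiv ℝ φ) x₀ := by
    rw [← key.fderiv_eq]
    exact (hasFDerivAt_vderiv (mdifferentiableAt_localDeriv (hf p))).fderiv.symm
  rw [hd]
  exact hφs.isSymmSndFDerivAt (by
    rw [minSmoothness_of_isRCLikeNormedField]
    exact WithTop.coe_le_coe.2 (le_top : (2 : ℕ∞) ≤ ⊤)) u v

end Local

/-! ### Levi-Civita connections in coordinates and their behaviour under restriction -/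

section Gauss
variable {E : Type*} [NormedAddCommGroup E] [NormedSpace ℝ E] [FiniteDimensional ℝ E]
  {M : Type*} [TopologicalSpace M] [ChartedSpace E M] [IsManifold 𝓘(ℝ, E) ∞ M]
  {E' : Type*} [NormedAddCommGroup E'] [NormedSpace ℝ E'] [FiniteDimensional ℝ E']
  {M' : Type*} [TopologicalSpace M'] [ChartedSpace E' M'] [IsManifold 𝓘(ℝ, E') ∞ M']

namespace PseudoRiemannianMetric

/-- The metric at `p` as a bilinear form on the model space. -/
def form (g : PseudoRiemannianMetric E M) (p : M) : E →L[ℝ] E →L[ℝ] ℝ := g.val p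

omit [FiniteDimensional ℝ E] in
theorem localForm_self (g : PseudoRiemannianMetric E M) (p : M) (u v : E) :
    g.localForm p p u v = g.form p u v :=
  (g.localForm_apply p p u v).trans
    (congrArg₂ (fun a b : E => g.form p a b) (symmL_tangent_self p u) (symmL_tangent_self p v))

omit [FiniteDimensional ℝ E] in
theorem dForm_eq (g : PseudoRiemannianMetric E M) (p : M) :
    g.dForm p = vderiv (E := E) (g.localForm p) p := rfl

omit [FiniteDimensional ℝ E] in
theorem dForm_symm (g : PseudoRiemannianMetric E M) (p : M) (u v w : E) :
    g.dForm p u v w = g.dForm p u w v := by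
  have h := hasFDerivAt_vderiv (E := E) (g.mdifferentiableAt_localForm p)
  have h1 := (h.clm_apply (hasFDerivAt_const v _)).clm_apply (hasFDerivAt_const w _)
  have h2 := (h.clm_apply (hasFDerivAt_const w _)).clm_apply (hasFDerivAt_const v _)
  have h3 : (fun x => (g.localForm p ∘ (extChartAt 𝓘(ℝ, E) p).symm) x v w)
      = fun x => (g.localForm p ∘ (extChartAt 𝓘(ℝ, E) p).symm) x w v := by
    funext x
    simp only [Function.comp, localForm_apply]
    exact g.symm _ _ _
  rw [h3] at h1
  simpa [dForm_eq] using congrArg (fun L : E →L[ℝ] ℝ => L u) (h1.unique h2)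

theorem two_mul_form_christoffel (g : PseudoRiemannianMetric E M) (p : M) (u v w : E) :
    2 * g.form p (g.christoffel p u v) w
      = g.dForm p u v w + g.dForm p v u w - g.dForm p w u v := by
  have h : g.flat p (g.christoffel p u v) = ((1 / 2 : ℝ) •
    ((g.dForm p u v + g.dForm p v u - ((g.dForm p).flip u).flip v : E →L[ℝ] ℝ) : E →ₗ[ℝ] ℝ)) :=
    LinearEquiv.apply_symm_apply _ _
  have h1 : g.flat p (g.christoffel p u v) w = g.form p (g.christoffel p u v) w := rfl
  rw [← h1, h]
  simp

omit [FiniteDimensional ℝ E] in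
theorem form_eq_zero (g : PseudoRiemannianMetric E M) (p : M) {u : E}
    (h : ∀ v, g.form p u v = 0) : u = 0 := g.nondegenerate p u h

theorem christoffel_symm (g : PseudoRiemannianMetric E M) (p : M) (u v : E) :
    g.christoffel p u v = g.christoffel p v u := by
  rw [← sub_eq_zero]
  refine g.form_eq_zero p fun w => ?_
  have h1 := g.two_mul_form_christoffel p u v w
  have h2 := g.two_mul_form_christoffel p v u w
  have h3 := g.dForm_symm p w u v
  rw [map_sub, sub_apply]
  linarith

end PseudoRiemannianMetric

omit [FiniteDimensional ℝ E] [IsManifold 𝓘(ℝ, E) ∞ M] in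
theorem vderiv_const {F : Type*} [NormedAddCommGroup F] [NormedSpace ℝ F] (c : F) (p : M) :
    vderiv (E := E) (fun _ : M => c) p = 0 := by
  exact mfderiv_const

/-- The field has constant components near `p`, so only the Christoffel term survives. -/
theorem nabla_coordField (g : PseudoRiemannianMetric E M) (p : M) (u v : E) :
    g.nabla (coordField (E := E) p v) p u = g.christoffel p u v := by
  have h : vderiv (E := E) (fun y : M => components p y (coordField (E := E) p v y)) p = 0 := by
    rw [← vderiv_const v p]
    refine vderiv_congr ?_
    filter_upwards [(chartAt E p).open_source.mem_nhds (mem_chart_source E p)] with y hy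
    exact components_coordField hy v
  have h1 : (vderiv (E := E) (fun y : M => components p y (coordField (E := E) p v y)) p) u
      + g.christoffel p u (coordField (E := E) p v p) = g.christoffel p u v := by
    rw [h]
    exact (zero_add _).trans (congrArg (g.christoffel p u) (symmL_tangent_self p v))
  exact h1

omit [FiniteDimensional ℝ E] [IsManifold 𝓘(ℝ, E) ∞ M] in
/-- The derivative of an operator-valued map applied to a fixed vector. -/
theorem vderiv_clm_apply {F G : Type*} [NormedAddCommGroup F] [NormedSpace ℝ F]
    [NormedAddCommGroup G] [NormedSpace ℝ G] {A : M → F →L[ℝ] G} {p : M}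
    (hA : MDifferentiableAt 𝓘(ℝ, E) 𝓘(ℝ, F →L[ℝ] G) A p) (u : E) (v : F) :
    vderiv (E := E) (fun y => A y v) p u = vderiv (E := E) A p u v := by
  have h := (hasFDerivAt_vderiv hA).clm_apply (hasFDerivAt_const v _)
  have hd : MDifferentiableAt 𝓘(ℝ, E) 𝓘(ℝ, G) (fun y => A y v) p :=
    hA.clm_apply mdifferentiableAt_const
  rw [vderiv_eq_of_hasFDerivAt hd h]
  simp

theorem nablaEnd_eq (S : HNStructure E M) (α : Fin 3) (p : M) (u v : E) :
    S.g.nablaEnd (S.J α) p u v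
      = vderiv (E := E) (localEnd (S.J α) p) p u v + S.g.christoffel p u (modelEnd (S.J α) p v)
        - modelEnd (S.J α) p (S.g.christoffel p u v) := by
  have h1 : S.g.nablaEnd (S.J α) p u v
    = (vderiv (E := E) (fun y => localEnd (S.J α) p y v) p u : E)
      + S.g.christoffel p u (modelEnd (S.J α) p (coordField (E := E) p v p))
      - modelEnd (S.J α) p (S.g.nabla (coordField (E := E) p v) p u) := rfl
  rw [h1, vderiv_clm_apply (mdifferentiableAt_localEnd (S.contMDiff_J α p)),
    nabla_coordField]
  have h2 : (coordField (E := E) p v p : E) = v := symmL_tangent_self p v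
  exact congrArg (fun w : E => vderiv (E := E) (localEnd (S.J α) p) p u v
    + S.g.christoffel p u (modelEnd (S.J α) p w) - modelEnd (S.J α) p _) h2

variable {f : M → M'}

theorem secondFundamentalForm_eq (hf : ContMDiff 𝓘(ℝ, E) 𝓘(ℝ, E') ∞ f)
    (g : PseudoRiemannianMetric E M) (g' : PseudoRiemannianMetric E' M') (p : M) (u v : E) :
    secondFundamentalForm f g g' p u v
      = vderiv (E := E) (localDeriv (E := E) (E' := E') f p) p u v
        + g'.christoffel (f p) (modelDeriv (E := E) (E' := E') f p u)
            (modelDeriv (E := E) (E' := E') f p v)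
        - modelDeriv (E := E) (E' := E') f p (g.christoffel p u v) := by
  have h1 : secondFundamentalForm f g g' p u v
    = vderiv (E := E) (fun y => localDeriv (E := E) (E' := E') f p y v) p u
      + g'.christoffel (f p) (modelDeriv (E := E) (E' := E') f p u)
          (modelDeriv (E := E) (E' := E') f p (coordField (E := E) p v p))
      - modelDeriv (E := E) (E' := E') f p (g.nabla (coordField (E := E) p v) p u) := rfl
  have h2 : (coordField (E := E) p v p : E) = v := symmL_tangent_self p v
  rw [h1, vderiv_clm_apply (mdifferentiableAt_localDeriv (hf p)), nabla_coordField]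
  exact congrArg (fun w : E => vderiv (E := E) (localDeriv (E := E) (E' := E') f p) p u v
    + g'.christoffel (f p) (modelDeriv (E := E) (E' := E') f p u)
      (modelDeriv (E := E) (E' := E') f p w)
    - modelDeriv (E := E) (E' := E') f p _) h2

theorem secondFundamentalForm_symm (hf : ContMDiff 𝓘(ℝ, E) 𝓘(ℝ, E') ∞ f)
    (g : PseudoRiemannianMetric E M) (g' : PseudoRiemannianMetric E' M') (p : M) (u v : E) :
    secondFundamentalForm f g g' p u v = secondFundamentalForm f g g' p v u := by
  rw [secondFundamentalForm_eq hf, secondFundamentalForm_eq hf, vderiv_localDeriv_symm hf,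
    g.christoffel_symm, g'.christoffel_symm]

omit [FiniteDimensional ℝ E] [FiniteDimensional ℝ E'] [IsManifold 𝓘(ℝ, E) ∞ M]
  [IsManifold 𝓘(ℝ, E') ∞ M'] in
theorem eventually_mem_source (hf : ContMDiff 𝓘(ℝ, E) 𝓘(ℝ, E') ∞ f) (p : M) :
    ∀ᶠ y in nhds p, y ∈ (chartAt E p).source ∧ f y ∈ (chartAt E' (f p)).source :=
  Filter.Eventually.and ((chartAt E p).open_source.mem_nhds (mem_chart_source E p))
    (hf.continuous.continuousAt.preimage_mem_nhds
      ((chartAt E' (f p)).open_source.mem_nhds (mem_chart_source E' (f p))))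

omit [FiniteDimensional ℝ E] [FiniteDimensional ℝ E'] in
-- Product rule for `g(v, w) = g'(A v, A w)`, with `A` the differential of `f` in charts.
theorem dForm_restriction (hf : ContMDiff 𝓘(ℝ, E) 𝓘(ℝ, E') ∞ f)
    {g : PseudoRiemannianMetric E M} {g' : PseudoRiemannianMetric E' M'}
    (hg : ∀ (p : M) (u v : TangentSpace 𝓘(ℝ, E) p),
      g.val p u v = g'.val (f p) (mfderiv 𝓘(ℝ, E) 𝓘(ℝ, E') f p u)
        (mfderiv 𝓘(ℝ, E) 𝓘(ℝ, E') f p v)) (p : M) (u v w : E) :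
    g.dForm p u v w
      = g'.dForm (f p) (modelDeriv (E := E) (E' := E') f p u)
          (modelDeriv (E := E) (E' := E') f p v) (modelDeriv (E := E) (E' := E') f p w)
        + g'.form (f p) (vderiv (E := E) (localDeriv (E := E) (E' := E') f p) p u v)
            (modelDeriv (E := E) (E' := E') f p w)
        + g'.form (f p) (modelDeriv (E := E) (E' := E') f p v)
            (vderiv (E := E) (localDeriv (E := E) (E' := E') f p) p u w) := by
  have hA := mdifferentiableAt_localDeriv (E := E) (E' := E') (hf p)
  have hG : MDifferentiableAt 𝓘(ℝ, E) 𝓘(ℝ, E' →L[ℝ] E' →L[ℝ] ℝ) (g'.localForm (f p) ∘ f) p :=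
    (g'.mdifferentiableAt_localForm (f p)).comp p ((hf p).mdifferentiableAt (by simp))
  have hG' := vderiv_comp (E := E) (g'.mdifferentiableAt_localForm (f p))
    ((hf p).mdifferentiableAt (by simp))
  have e1 := vderiv_clm_apply (E := E) ((g.mdifferentiableAt_localForm p).clm_apply
    (mdifferentiableAt_const (c := v))) u w
  rw [vderiv_clm_apply (g.mdifferentiableAt_localForm p)] at e1
  have hev : (fun y => g.localForm p y v w) =ᶠ[nhds p] fun y =>
      (g'.localForm (f p) ∘ f) y (localDeriv (E := E) (E' := E') f p y v)
        (localDeriv (E := E) (E' := E') f p y w) := by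
    filter_upwards [eventually_mem_source hf p] with y hy
    rw [g.localForm_apply, hg, Function.comp, g'.localForm_apply, localDeriv_apply,
      localDeriv_apply, coordField_components hy.2, coordField_components hy.2]
  rw [vderiv_congr hev] at e1
  have d1 := (hasFDerivAt_vderiv hA).clm_apply (hasFDerivAt_const v _)
  have d2 := (hasFDerivAt_vderiv hA).clm_apply (hasFDerivAt_const w _)
  have d3 := ((hasFDerivAt_vderiv hG).clm_apply d1).clm_apply d2
  have hm : MDifferentiableAt 𝓘(ℝ, E) 𝓘(ℝ, ℝ) (fun y =>
      (g'.localForm (f p) ∘ f) y (localDeriv (E := E) (E' := E') f p y v)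
        (localDeriv (E := E) (E' := E') f p y w)) p :=
    (hG.clm_apply (hA.clm_apply mdifferentiableAt_const)).clm_apply
      (hA.clm_apply mdifferentiableAt_const)
  rw [vderiv_eq_of_hasFDerivAt hm d3, hG'] at e1
  rw [g.dForm_eq, ← e1]
  simp [g'.localForm_self, localDeriv_self, g'.dForm_eq]
  ring

omit [FiniteDimensional ℝ E] [FiniteDimensional ℝ E'] in
-- Product rule for `A J_α = J'_α A`, with `A` the differential of `f` in charts.
theorem localEnd_restriction (hf : ContMDiff 𝓘(ℝ, E) 𝓘(ℝ, E') ∞ f)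
    {S : HNStructure E M} {S' : HNStructure E' M'} (hS : IsRestriction f S S') (α : Fin 3)
    (p : M) (u v : E) :
    vderiv (E := E) (localDeriv (E := E) (E' := E') f p) p u (modelEnd (S.J α) p v)
      + modelDeriv (E := E) (E' := E') f p (vderiv (E := E) (localEnd (S.J α) p) p u v)
    = vderiv (E := E') (localEnd (S'.J α) (f p)) (f p) (modelDeriv (E := E) (E' := E') f p u)
        (modelDeriv (E := E) (E' := E') f p v)
      + modelEnd (S'.J α) (f p)
          (vderiv (E := E) (localDeriv (E := E) (E' := E') f p) p u v) := by
  have hA := mdifferentiableAt_localDeriv (E := E) (E' := E') (hf p)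
  have hJ := mdifferentiableAt_localEnd (E := E) (S.contMDiff_J α p)
  have hJ' := mdifferentiableAt_localEnd (E := E') (S'.contMDiff_J α (f p))
  have hG : MDifferentiableAt 𝓘(ℝ, E) 𝓘(ℝ, E' →L[ℝ] E') (localEnd (S'.J α) (f p) ∘ f) p :=
    hJ'.comp p ((hf p).mdifferentiableAt (by simp))
  have hG' := vderiv_comp (E := E) hJ' ((hf p).mdifferentiableAt (by simp))
  have hev : (fun y => localDeriv (E := E) (E' := E') f p y (localEnd (S.J α) p y v))
      =ᶠ[nhds p] fun y => (localEnd (S'.J α) (f p) ∘ f) y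
        (localDeriv (E := E) (E' := E') f p y v) := by
    filter_upwards [eventually_mem_source hf p] with y hy
    rw [localDeriv_apply, localEnd_apply, coordField_components hy.1, hS.J_eq, Function.comp,
      localEnd_apply, localDeriv_apply, coordField_components hy.2]
  have d1 := (hasFDerivAt_vderiv hA).clm_apply (hasFDerivAt_const v _)
  have d2 := (hasFDerivAt_vderiv hG).clm_apply d1
  have d3 := (hasFDerivAt_vderiv hJ).clm_apply (hasFDerivAt_const v _)
  have d4 := (hasFDerivAt_vderiv hA).clm_apply d3
  have e := vderiv_congr (E := E) hev
  rw [vderiv_eq_of_hasFDerivAt (hA.clm_apply (hJ.clm_apply mdifferentiableAt_const)) d4,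
    vderiv_eq_of_hasFDerivAt (hG.clm_apply (hA.clm_apply mdifferentiableAt_const)) d2, hG'] at e
  have e2 := congrArg (fun L : E →L[ℝ] E' => L u) e
  simp [localDeriv_self, localEnd_self] at e2
  rw [add_comm, e2, add_comm]

end Gauss

/-! ### Bilinear forms commuting with a hypercomplex structure; metric traces -/

section Algebra

variable {V W : Type*} [AddCommGroup V] [AddCommGroup W]
  {P : W → Prop} {J : Fin 3 → V → V} {K : Fin 3 → W → W} {g : V → V → ℝ}
  {b : W → V → V → ℝ} {t : Fin 3 → W → ℝ} {c c' : ℝ}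

omit [AddCommGroup V] in
/-- A symmetric form that commutes with a hypercomplex structure up to multiples of a
Hermitian-Norden form `g` is conformal to `g`. -/
theorem conformal_of_commutation
    (hP : ∀ α N, P N → P (K α N)) (hK : ∀ α N, K α (K α N) = -N)
    (hJ : ∀ v, J 0 v = J 1 (J 2 v))
    (hg0 : ∀ u v, g (J 0 u) (J 0 v) = g u v)
    (hg1 : ∀ α, α = 1 ∨ α = 2 → ∀ u v, g (J α u) (J α v) = -g u v)
    (hgs : ∀ u v, g u v = g v u)
    (hb : ∀ N u v, b N u v = b N v u)
    (hbN : ∀ N u v, b (-N) u v = -b N u v) (ht : ∀ α N, t α (-N) = -t α N)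
    (h0 : ∀ N, P N → ∀ u v, b N u (J 0 v) + b (K 0 N) u v
      = c * (g u v * t 0 N - g u (J 0 v) * t 0 (K 0 N)))
    (h1 : ∀ α, α = 1 ∨ α = 2 → ∀ N, P N → ∀ u v, b N u (J α v) - b (K α N) u v
      = c' * (g u v * t α N + g u (J α v) * t α (K α N)))
    {N : W} (hN : P N) (u v : V) : b N u v = g u v * (-c * t 0 (K 0 N)) := by
  -- The relation at `N` and the one at `K 0 N` share the term `b (K 0 N) (J 0 u) v` by symmetry;
  -- eliminating it leaves a Lee term.
  have e0 : b N (J 0 u) (J 0 v) = -b N u v - 2 * c * g u v * t 0 (K 0 N) := by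
    have a1 := h0 N hN (J 0 u) v
    have a2 := h0 (K 0 N) (hP 0 N hN) v u
    rw [hK, hbN, ht, ← hb (K 0 N) (J 0 u) v, hb N v u, hgs v u, hgs v (J 0 u)] at a2
    rw [hg0] at a1
    linear_combination a1 - a2
  -- The same elimination; now the Norden sign `g (J α u) (J α v) = -g u v` cancels all Lee terms.
  have e1 : ∀ α, α = 1 ∨ α = 2 → ∀ u v, b N (J α u) (J α v) = -b N u v := by
    intro α hα u v
    have a1 := h1 α hα N hN (J α u) v
    have a2 := h1 α hα (K α N) (hP α N hN) v u
    rw [hK, hbN, ht, ← hb (K α N) (J α u) v, hb N v u, hgs v u, hgs v (J α u)] at a2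
    rw [hg1 α hα] at a1
    linear_combination a1 + a2
  have e2 : b N (J 0 u) (J 0 v) = b N u v := by
    rw [hJ, hJ, e1 1 (Or.inl rfl), e1 2 (Or.inr rfl), neg_neg]
  linear_combination (1 / 2) * e0 - (1 / 2) * e2

/-- If a conformal form satisfies the commutation relation of a Norden structure, its conformal
factor is determined by that relation. -/
theorem conformal_factor_eq {K : W → W} {J : V → V} {t γ : W → ℝ}
    (hP : ∀ N, P N → P (K N)) (hK : ∀ N, K (K N) = -N) (hJ : ∀ v, J (J v) = -v)
    (hg : ∀ u v, g u (-v) = -g u v) (ht : ∀ N, t (-N) = -t N)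
    (hb : ∀ N, P N → ∀ u v, b N u v = g u v * γ N)
    (h1 : ∀ N, P N → ∀ u v, b N u (J v) - b (K N) u v
      = c' * (g u v * t N + g u (J v) * t (K N)))
    {N : W} (hN : P N) {u v : V} (huv : g u v ≠ 0) : γ N = c' * t (K N) := by
  -- The two brackets, `d` and `e` below, are the errors in the claimed formula at `N` and at `K N`.
  have key : ∀ v, g u (J v) * (γ N - c' * t (K N)) = g u v * (γ (K N) - c' * t (K (K N))) := by
    intro v
    have a := h1 N hN u v
    rw [hb N hN, hb _ (hP N hN)] at a
    rw [hK, ht]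
    linear_combination a
  have k1 := key v
  have k2 := key (J v)
  rw [hJ, hg] at k2
  set d := γ N - c' * t (K N)
  set e := γ (K N) - c' * t (K (K N))
  -- Eliminating `g u (J v)` between the relations at `v` and `J v` produces a sum of squares
  -- because `J² = -1`.
  have k3 : g u v * (d ^ 2 + e ^ 2) = 0 := by linear_combination -e * k1 - d * k2
  have k4 : d ^ 2 + e ^ 2 = 0 := (mul_eq_zero.1 k3).resolve_left huv
  have k5 : d = 0 := by nlinarith [sq_nonneg d, sq_nonneg e]
  linarith

theorem map_metricTrace {V W W' : Type*} [AddCommGroup V] [Module ℝ V] [FiniteDimensional ℝ V]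
    [AddCommGroup W] [Module ℝ W] [AddCommGroup W'] [Module ℝ W'] (L : W →ₗ[ℝ] W')
    (g : V → V → ℝ) (B : V → V → W) :
    L (metricTrace g B) = metricTrace g fun u v => L (B u v) := by
  simp [metricTrace, map_sum]

/-- The trace is that of `G⁻¹ G = 1`. The Gram matrix `G` is invertible because a null vector of it
would give a vector in the radical of `g`. -/
theorem metricTrace_self {V : Type*} [AddCommGroup V] [Module ℝ V] [FiniteDimensional ℝ V]
    (g : V →ₗ[ℝ] V →ₗ[ℝ] ℝ) (hs : ∀ u v, g u v = g v u) (hn : ∀ u, (∀ v, g u v = 0) → u = 0) :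
    metricTrace (fun u v => g u v) (fun u v => g u v) = (Module.finrank ℝ V : ℝ) := by
  set e := Module.finBasis ℝ V
  set G : Matrix (Fin (Module.finrank ℝ V)) (Fin (Module.finrank ℝ V)) ℝ :=
    Matrix.of fun k l => g (e k) (e l) with hG
  have hdet : IsUnit G.det := by
    rw [isUnit_iff_ne_zero]
    intro h
    obtain ⟨x, hx, hGx⟩ := Matrix.exists_mulVec_eq_zero_iff.2 h
    have hu : ∑ j, x j • e j = 0 := by
      refine hn _ fun v => ?_
      rw [hs]
      have hz : (g.flip (∑ j, x j • e j)) = 0 := by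
        refine e.ext fun i => ?_
        have := congrFun hGx i
        simp only [Matrix.mulVec, dotProduct, hG, Matrix.of_apply, Pi.zero_apply] at this
        simp only [map_sum, map_smul, LinearMap.sum_apply, LinearMap.smul_apply,
          LinearMap.flip_apply, smul_eq_mul, LinearMap.zero_apply]
        rw [← this]
        exact Finset.sum_congr rfl fun j _ => mul_comm (x j) _
      exact LinearMap.congr_fun hz v
    exact hx (funext (Fintype.linearIndependent_iff.1 e.linearIndependent x hu))
  have h1 : metricTrace (fun u v => g u v) (fun u v => g u v) = (G⁻¹ * G).trace := by
    simp only [metricTrace, Matrix.trace, Matrix.diag, Matrix.mul_apply, smul_eq_mul]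
    refine Finset.sum_congr rfl fun i _ => Finset.sum_congr rfl fun j _ => ?_
    rw [hs]
    rfl
  rw [h1, Matrix.nonsing_inv_mul _ hdet]
  simp

end Algebra

/-! ### The Gauss formula for an isometric immersion -/

section Submanifold

variable {E : Type*} [NormedAddCommGroup E] [NormedSpace ℝ E] [FiniteDimensional ℝ E]
  {M : Type*} [TopologicalSpace M] [ChartedSpace E M] [IsManifold 𝓘(ℝ, E) ∞ M]
  {E' : Type*} [NormedAddCommGroup E'] [NormedSpace ℝ E'] [FiniteDimensional ℝ E']
  {M' : Type*} [TopologicalSpace M'] [ChartedSpace E' M'] [IsManifold 𝓘(ℝ, E') ∞ M']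
  {f : M → M'}

omit [FiniteDimensional ℝ E] in
theorem PseudoRiemannianMetric.form_symm (g : PseudoRiemannianMetric E M) (p : M) (u v : E) :
    g.form p u v = g.form p v u := g.symm p u v

/-- The second fundamental form as a form on the model space. -/
def modelSecond (f : M → M') (g : PseudoRiemannianMetric E M) (g' : PseudoRiemannianMetric E' M')
    (p : M) (u v : E) : E' := secondFundamentalForm f g g' p u v

/-- Both Christoffel terms are expanded through the derivatives of the metrics; `dForm_restriction`
and the symmetry of second derivatives make everything cancel. Thus the tangential part of `∇'` is
`∇`. -/
theorem form_modelSecond_tangent (hf : ContMDiff 𝓘(ℝ, E) 𝓘(ℝ, E') ∞ f)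
    {g : PseudoRiemannianMetric E M} {g' : PseudoRiemannianMetric E' M'}
    (hg : ∀ (p : M) (u v : TangentSpace 𝓘(ℝ, E) p),
      g.val p u v = g'.val (f p) (mfderiv 𝓘(ℝ, E) 𝓘(ℝ, E') f p u)
        (mfderiv 𝓘(ℝ, E) 𝓘(ℝ, E') f p v)) (p : M) (u v w : E) :
    g'.form (f p) (modelSecond f g g' p u v) (modelDeriv (E := E) (E' := E') f p w) = 0 := by
  have h : modelSecond f g g' p u v = _ := secondFundamentalForm_eq hf g g' p u v
  have hgf : ∀ u v, g'.form (f p) (modelDeriv (E := E) (E' := E') f p u)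
      (modelDeriv (E := E) (E' := E') f p v) = g.form p u v := fun u v => (hg p u v).symm
  rw [h, map_sub, map_add]
  simp only [sub_apply, add_apply]
  rw [hgf]
  have c1 := g.two_mul_form_christoffel p u v w
  have c2 := g'.two_mul_form_christoffel (f p) (modelDeriv (E := E) (E' := E') f p u)
    (modelDeriv (E := E) (E' := E') f p v) (modelDeriv (E := E) (E' := E') f p w)
  have d1 := dForm_restriction hf hg p u v w
  have d2 := dForm_restriction hf hg p v u w
  have d3 := dForm_restriction hf hg p w u v
  rw [vderiv_localDeriv_symm hf p v u] at d2
  rw [vderiv_localDeriv_symm hf p w u, vderiv_localDeriv_symm hf p w v,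
    g'.form_symm (f p) (vderiv (E := E) (localDeriv (E := E) (E' := E') f p) p u w)] at d3
  linear_combination (1 / 2) * c2 - (1 / 2) * c1 - (1 / 2) * d1 - (1 / 2) * d2 + (1 / 2) * d3

/-- Gauss formula for the covariant derivatives of the structures, up to a tangent vector. -/
theorem nablaEnd_restriction (hf : ContMDiff 𝓘(ℝ, E) 𝓘(ℝ, E') ∞ f)
    {S : HNStructure E M} {S' : HNStructure E' M'} (hS : IsRestriction f S S') (α : Fin 3)
    (p : M) (u v : E) :
    ∃ w : E, (S'.g.nablaEnd (S'.J α) (f p) (modelDeriv (E := E) (E' := E') f p u)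
        (modelDeriv (E := E) (E' := E') f p v) : E')
      = modelSecond f S.g S'.g p u (modelEnd (S.J α) p v)
        - modelEnd (S'.J α) (f p) (modelSecond f S.g S'.g p u v)
        + modelDeriv (E := E) (E' := E') f p w := by
  -- The tangent vector is `(∇_u J_α) v`, computed on `M`.
  refine ⟨S.g.nablaEnd (S.J α) p u v, ?_⟩
  have hJ : ∀ w, modelDeriv (E := E) (E' := E') f p (modelEnd (S.J α) p w)
      = modelEnd (S'.J α) (f p) (modelDeriv (E := E) (E' := E') f p w) := fun w => hS.J_eq α p w
  have h1 : modelSecond f S.g S'.g p u (modelEnd (S.J α) p v) = _ :=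
    secondFundamentalForm_eq hf S.g S'.g p u (modelEnd (S.J α) p v)
  have h2 : modelSecond f S.g S'.g p u v = _ := secondFundamentalForm_eq hf S.g S'.g p u v
  have h3 := localEnd_restriction hf hS α p u v
  rw [nablaEnd_eq, nablaEnd_eq, h1, h2]
  simp only [map_add, map_sub, hJ]
  have h4 := eq_sub_of_add_eq h3.symm
  rw [h4]
  abel

end Submanifold

/-! ### Umbilicity and the mean curvature vector in terms of the Lee forms -/

section Umbilical

variable {E : Type*} [NormedAddCommGroup E] [NormedSpace ℝ E] [FiniteDimensional ℝ E]
  {M : Type*} [TopologicalSpace M] [ChartedSpace E M] [IsManifold 𝓘(ℝ, E) ∞ M]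
  {E' : Type*} [NormedAddCommGroup E'] [NormedSpace ℝ E'] [FiniteDimensional ℝ E']
  {M' : Type*} [TopologicalSpace M'] [ChartedSpace E' M'] [IsManifold 𝓘(ℝ, E') ∞ M']
  {f : M → M'}

theorem HNStructure.leeForm_neg (S : HNStructure E M) (α : Fin 3) (p : M) (Z : E) :
    S.leeForm α p (-Z) = -S.leeForm α p Z := by
  have hF : ∀ X Y : E, S.F α p X Y (-Z) = -S.F α p X Y Z := fun X Y => map_neg _ _
  simp only [HNStructure.leeForm, metricTrace, hF, smul_neg, Finset.sum_neg_distrib]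

omit [FiniteDimensional ℝ E] in
theorem HNStructure.form_J_zero (S : HNStructure E M) (p : M) (u v : E) :
    S.g.form p (modelEnd (S.J 0) p u) v = -S.g.form p u (modelEnd (S.J 0) p v) := by
  have h1 : S.g.form p (modelEnd (S.J 0) p (modelEnd (S.J 0) p u)) (modelEnd (S.J 0) p v)
      = S.g.form p (modelEnd (S.J 0) p u) v := S.hermitian p _ _
  have h2 : modelEnd (S.J 0) p (modelEnd (S.J 0) p u) = -u := S.J_sq 0 p u
  rw [← h1, h2, map_neg, neg_apply]

omit [FiniteDimensional ℝ E] in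
theorem HNStructure.form_J_J (S : HNStructure E M) {α : Fin 3} (hα : α = 1 ∨ α = 2) (p : M)
    (u v : E) :
    S.g.form p (modelEnd (S.J α) p u) (modelEnd (S.J α) p v) = -S.g.form p u v := by
  rcases hα with rfl | rfl
  exacts [S.norden_two p u v, S.norden_three p u v]

omit [FiniteDimensional ℝ E] in
theorem HNStructure.form_J (S : HNStructure E M) {α : Fin 3} (hα : α = 1 ∨ α = 2) (p : M)
    (u v : E) :
    S.g.form p (modelEnd (S.J α) p u) v = S.g.form p u (modelEnd (S.J α) p v) := by
  have h1 := S.form_J_J hα p (modelEnd (S.J α) p u) v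
  have h2 : modelEnd (S.J α) p (modelEnd (S.J α) p u) = -u := S.J_sq α p u
  rw [h2, map_neg, neg_apply] at h1
  linarith

/-- A vector of the model space is normal to the submanifold at `p`. -/
def IsNormal (f : M → M') (g' : PseudoRiemannianMetric E' M') (p : M) (N : E') : Prop :=
  ∀ u : E, g'.form (f p) N (modelDeriv (E := E) (E' := E') f p u) = 0

omit [FiniteDimensional ℝ E] [FiniteDimensional ℝ E'] [IsManifold 𝓘(ℝ, E) ∞ M] in
theorem IsNormal.form_modelDeriv {g' : PseudoRiemannianMetric E' M'} {p : M} {N : E'}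
    (hN : IsNormal (E := E) f g' p N) (u : E) :
    g'.form (f p) (modelDeriv (E := E) (E' := E') f p u) N = 0 :=
  (g'.form_symm _ _ _).trans (hN u)

variable {S : HNStructure E M} {S' : HNStructure E' M'}

omit [FiniteDimensional ℝ E] [FiniteDimensional ℝ E'] in
theorem IsRestriction.form_eq (hS : IsRestriction f S S') (p : M) (u v : E) :
    S'.g.form (f p) (modelDeriv (E := E) (E' := E') f p u)
      (modelDeriv (E := E) (E' := E') f p v) = S.g.form p u v := (hS.g_eq p u v).symm

omit [FiniteDimensional ℝ E] [FiniteDimensional ℝ E'] in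
theorem IsRestriction.modelDeriv_J (hS : IsRestriction f S S') (α : Fin 3) (p : M) (w : E) :
    modelDeriv (E := E) (E' := E') f p (modelEnd (S.J α) p w)
      = modelEnd (S'.J α) (f p) (modelDeriv (E := E) (E' := E') f p w) := hS.J_eq α p w

omit [FiniteDimensional ℝ E] [FiniteDimensional ℝ E'] in
-- `J_α` is skew or self-adjoint and preserves tangent vectors, hence also their orthogonal
-- complement.
theorem IsNormal.map_J (hS : IsRestriction f S S') {p : M} {N : E'}
    (hN : IsNormal (E := E) f S'.g p N) (α : Fin 3) :
    IsNormal (E := E) f S'.g p (modelEnd (S'.J α) (f p) N) := by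
  intro u
  have h : α = 0 ∨ α = 1 ∨ α = 2 := by fin_cases α <;> simp
  rcases h with rfl | hα
  · rw [S'.form_J_zero, ← hS.modelDeriv_J, hN, neg_zero]
  · rw [S'.form_J hα, ← hS.modelDeriv_J, hN]

omit [FiniteDimensional ℝ E'] in
/-- A normal vector orthogonal to all normal vectors is zero, since the restricted metric is
non-degenerate. -/
theorem IsNormal.eq_zero (hS : IsRestriction f S S') {p : M} {x : E'}
    (hx : IsNormal (E := E) f S'.g p x)
    (h : ∀ N, IsNormal (E := E) f S'.g p N → S'.g.form (f p) x N = 0) : x = 0 := by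
  refine S'.g.form_eq_zero (f p) fun y => ?_
  -- `w` represents the orthogonal projection of `y` to the tangent space; it exists because the
  -- metric of `M` is non-degenerate. Then `y` minus the image of `w` is normal.
  set w : E := (S.g.flat p).symm
    ((S'.g.form (f p) y : E' →ₗ[ℝ] ℝ) ∘ₗ (modelDeriv (E := E) (E' := E') f p : E →ₗ[ℝ] E'))
    with hw
  have hwv : ∀ v, S.g.form p w v = S'.g.form (f p) y (modelDeriv (E := E) (E' := E') f p v) := by
    intro v
    have : S.g.flat p w = _ := LinearEquiv.apply_symm_apply _ _
    exact LinearMap.congr_fun this v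
  have hN := h (y - modelDeriv (E := E) (E' := E') f p w) fun v => by
    rw [map_sub, sub_apply, hS.form_eq, hwv, sub_self]
  rw [map_sub, hx, sub_zero] at hN
  exact hN

/-- Pairing the Gauss formula with `N` removes the tangent term, and skewness of `J_1` moves it onto
`N` with a plus sign. Two of the four terms of `F_1` vanish since `N` and `J_1 N` are normal. -/
theorem second_commutation_zero {n : ℕ} (hf : ContMDiff 𝓘(ℝ, E) 𝓘(ℝ, E') ∞ f)
    (hS : IsRestriction f S S') (hW : S'.IsWManifold n) {p : M} {N : E'}
    (hN : IsNormal (E := E) f S'.g p N) (u v : E) :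
    S'.g.form (f p) (modelSecond f S.g S'.g p u (modelEnd (S.J 0) p v)) N
      + S'.g.form (f p) (modelSecond f S.g S'.g p u v) (modelEnd (S'.J 0) (f p) N)
    = 1 / (2 * (2 * (n : ℝ) - 1)) * (S.g.form p u v * S'.leeForm 0 (f p) N
      - S.g.form p u (modelEnd (S.J 0) p v)
        * S'.leeForm 0 (f p) (modelEnd (S'.J 0) (f p) N)) := by
  obtain ⟨w, hw⟩ := nablaEnd_restriction hf hS 0 p u v
  have h : S'.g.form (f p) (S'.g.nablaEnd (S'.J 0) (f p) (modelDeriv (E := E) (E' := E') f p u)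
        (modelDeriv (E := E) (E' := E') f p v)) N
      = 1 / (2 * (2 * (n : ℝ) - 1)) *
        (S'.g.form (f p) (modelDeriv (E := E) (E' := E') f p u)
            (modelDeriv (E := E) (E' := E') f p v) * S'.leeForm 0 (f p) N
          - S'.g.form (f p) (modelDeriv (E := E) (E' := E') f p u) N
            * S'.leeForm 0 (f p) (modelDeriv (E := E) (E' := E') f p v)
          - S'.g.form (f p) (modelDeriv (E := E) (E' := E') f p u)
              (modelEnd (S'.J 0) (f p) (modelDeriv (E := E) (E' := E') f p v))
            * S'.leeForm 0 (f p) (modelEnd (S'.J 0) (f p) N)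
          + S'.g.form (f p) (modelDeriv (E := E) (E' := E') f p u) (modelEnd (S'.J 0) (f p) N)
            * S'.leeForm 0 (f p)
              (modelEnd (S'.J 0) (f p) (modelDeriv (E := E) (E' := E') f p v))) :=
    hW.F_one (f p) _ _ _
  rw [hw, ← hS.modelDeriv_J, hS.form_eq, hS.form_eq,
    hN.form_modelDeriv, (hN.map_J hS 0).form_modelDeriv,
    map_add, map_sub, add_apply, sub_apply, S'.form_J_zero, hN.form_modelDeriv] at h
  linear_combination h

/-- As for `J_1`, except that self-adjointness of `J_α` gives a minus sign on the left. -/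
theorem second_commutation_norden {n : ℕ} (hf : ContMDiff 𝓘(ℝ, E) 𝓘(ℝ, E') ∞ f)
    (hS : IsRestriction f S S') (hW : S'.IsWManifold n) {α : Fin 3} (hα : α = 1 ∨ α = 2)
    {p : M} {N : E'} (hN : IsNormal (E := E) f S'.g p N) (u v : E) :
    S'.g.form (f p) (modelSecond f S.g S'.g p u (modelEnd (S.J α) p v)) N
      - S'.g.form (f p) (modelSecond f S.g S'.g p u v) (modelEnd (S'.J α) (f p) N)
    = 1 / (4 * (n : ℝ)) * (S.g.form p u v * S'.leeForm α (f p) N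
      + S.g.form p u (modelEnd (S.J α) p v)
        * S'.leeForm α (f p) (modelEnd (S'.J α) (f p) N)) := by
  obtain ⟨w, hw⟩ := nablaEnd_restriction hf hS α p u v
  have h : S'.g.form (f p) (S'.g.nablaEnd (S'.J α) (f p) (modelDeriv (E := E) (E' := E') f p u)
        (modelDeriv (E := E) (E' := E') f p v)) N
      = 1 / (4 * (n : ℝ)) *
        (S'.g.form (f p) (modelDeriv (E := E) (E' := E') f p u)
            (modelDeriv (E := E) (E' := E') f p v) * S'.leeForm α (f p) N
          + S'.g.form (f p) (modelDeriv (E := E) (E' := E') f p u) N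
            * S'.leeForm α (f p) (modelDeriv (E := E) (E' := E') f p v)
          + S'.g.form (f p) (modelDeriv (E := E) (E' := E') f p u)
              (modelEnd (S'.J α) (f p) (modelDeriv (E := E) (E' := E') f p v))
            * S'.leeForm α (f p) (modelEnd (S'.J α) (f p) N)
          + S'.g.form (f p) (modelDeriv (E := E) (E' := E') f p u) (modelEnd (S'.J α) (f p) N)
            * S'.leeForm α (f p)
              (modelEnd (S'.J α) (f p) (modelDeriv (E := E) (E' := E') f p v))) :=
    hW.F_two_three α hα (f p) _ _ _
  rw [hw, ← hS.modelDeriv_J, hS.form_eq, hS.form_eq,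
    hN.form_modelDeriv, (hN.map_J hS α).form_modelDeriv,
    map_add, map_sub, add_apply, sub_apply, S'.form_J hα, hN.form_modelDeriv] at h
  linear_combination h

/-- The component of the mean curvature vector along the normal vector `N`. -/
def normalFactor (S' : HNStructure E' M') (n : ℕ) (q : M') (N : E') : ℝ :=
  -(1 / (2 * (2 * (n : ℝ) - 1))) * S'.leeForm 0 q (modelEnd (S'.J 0) q N)

theorem form_modelSecond_normal {n : ℕ} (hf : ContMDiff 𝓘(ℝ, E) 𝓘(ℝ, E') ∞ f)
    (hS : IsRestriction f S S') (hW : S'.IsWManifold n) {p : M} {N : E'}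
    (hN : IsNormal (E := E) f S'.g p N) (u v : E) :
    S'.g.form (f p) (modelSecond f S.g S'.g p u v) N
      = S.g.form p u v * normalFactor S' n (f p) N :=
  conformal_of_commutation (P := IsNormal (E := E) f S'.g p)
    (J := fun α v => modelEnd (S.J α) p v) (K := fun α N => modelEnd (S'.J α) (f p) N)
    (g := fun u v => S.g.form p u v)
    (b := fun N u v => S'.g.form (f p) (modelSecond f S.g S'.g p u v) N)
    (t := fun α N => S'.leeForm α (f p) N) (c' := 1 / (4 * (n : ℝ)))
    (fun α _ hN => hN.map_J hS α) (fun α N => S'.J_sq α (f p) N) (fun v => S.J_cyclic 0 p v)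
    (fun u v => S.hermitian p u v) (fun _ hα u v => S.form_J_J hα p u v)
    (fun u v => S.g.form_symm p u v)
    (fun N u v => congrArg (fun x : E' => S'.g.form (f p) x N)
      (secondFundamentalForm_symm hf S.g S'.g p u v))
    (fun _ _ _ => map_neg _ _) (fun α N => S'.leeForm_neg α (f p) N)
    (fun _ hN u v => second_commutation_zero hf hS hW hN u v)
    (fun _ hα _ hN u v => second_commutation_norden hf hS hW hα hN u v) hN u v

/-- This links `θ_1` with `θ_2` and `θ_3` on the normal space, so that each of the three detects
`C`. A pair with `g(u, v) ≠ 0` exists because the tangent space is non-zero. -/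
theorem normalFactor_eq {n : ℕ} (hf : ContMDiff 𝓘(ℝ, E) 𝓘(ℝ, E') ∞ f)
    (hS : IsRestriction f S S') (hW : S'.IsWManifold n) {α : Fin 3} (hα : α = 1 ∨ α = 2)
    [Nontrivial E] {p : M} {N : E'} (hN : IsNormal (E := E) f S'.g p N) :
    normalFactor S' n (f p) N
      = 1 / (4 * (n : ℝ)) * S'.leeForm α (f p) (modelEnd (S'.J α) (f p) N) := by
  obtain ⟨u, hu⟩ := exists_ne (0 : E)
  obtain ⟨v, huv⟩ : ∃ v, S.g.form p u v ≠ 0 := by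
    by_contra! h
    exact hu (S.g.form_eq_zero p h)
  exact conformal_factor_eq (P := IsNormal (E := E) f S'.g p)
    (J := fun v => modelEnd (S.J α) p v) (K := fun N => modelEnd (S'.J α) (f p) N)
    (g := fun u v => S.g.form p u v)
    (b := fun N u v => S'.g.form (f p) (modelSecond f S.g S'.g p u v) N)
    (t := fun N => S'.leeForm α (f p) N)
    (fun _ hN => hN.map_J hS α) (fun N => S'.J_sq α (f p) N) (fun v => S.J_sq α p v)
    (fun u v => map_neg _ _) (fun N => S'.leeForm_neg α (f p) N)
    (fun _ hN u v => form_modelSecond_normal hf hS hW hN u v)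
    (fun _ hN u v => second_commutation_norden hf hS hW hα hN u v) hN huv

/-- The mean curvature vector as a vector of the model space. -/
def modelMean (f : M → M') (g : PseudoRiemannianMetric E M) (g' : PseudoRiemannianMetric E' M')
    (p : M) : E' := meanCurvature f g g' p

theorem form_modelMean (g : PseudoRiemannianMetric E M) (g' : PseudoRiemannianMetric E' M')
    (p : M) (y : E') :
    g'.form (f p) (modelMean f g g' p) y
      = (1 / (Module.finrank ℝ E : ℝ)) * metricTrace (V := E) (fun u v => g.form p u v)
        (fun u v => g'.form (f p) (modelSecond f g g' p u v) y) := by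
  set L : E' →ₗ[ℝ] ℝ := ((g'.form (f p)).flip y : E' →ₗ[ℝ] ℝ) with hL
  have h1 : g'.form (f p) (modelMean f g g' p) y = L ((1 / (Module.finrank ℝ E : ℝ)) •
      metricTrace (V := E) (fun u v => g.form p u v) (modelSecond f g g' p)) := rfl
  rw [h1, map_smul, map_metricTrace, smul_eq_mul]
  rfl

theorem modelMean_isNormal (hf : ContMDiff 𝓘(ℝ, E) 𝓘(ℝ, E') ∞ f)
    (hS : IsRestriction f S S') (p : M) :
    IsNormal (E := E) f S'.g p (modelMean f S.g S'.g p) := by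
  intro w
  rw [form_modelMean]
  simp only [form_modelSecond_tangent hf hS.g_eq]
  simp [metricTrace]

/-- The trace of `g` with respect to itself is `dim M`, which cancels the normalization of `C`. -/
theorem form_modelMean_normal {n : ℕ} (hf : ContMDiff 𝓘(ℝ, E) 𝓘(ℝ, E') ∞ f)
    (hS : IsRestriction f S S') (hW : S'.IsWManifold n) [Nontrivial E] {p : M} {N : E'}
    (hN : IsNormal (E := E) f S'.g p N) :
    S'.g.form (f p) (modelMean f S.g S'.g p) N = normalFactor S' n (f p) N := by
  have h1 := metricTrace_self (V := E)
    ((ContinuousLinearMap.coeLM ℝ : (E →L[ℝ] ℝ) →ₗ[ℝ] (E →ₗ[ℝ] ℝ)) ∘ₗ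
      (S.g.form p : E →ₗ[ℝ] E →L[ℝ] ℝ)) (fun u v => S.g.form_symm p u v)
    (fun u hu => S.g.form_eq_zero p hu)
  have h2 := map_metricTrace (LinearMap.mulRight ℝ (normalFactor S' n (f p) N))
    (fun u v : E => S.g.form p u v) (fun u v : E => S.g.form p u v)
  rw [form_modelMean]
  simp only [form_modelSecond_normal hf hS hW hN]
  have h3 : metricTrace (fun u v : E => S.g.form p u v) (fun u v : E => S.g.form p u v)
      = (Module.finrank ℝ E : ℝ) := h1
  simp only [LinearMap.mulRight_apply] at h2
  rw [← h2, h3, ← mul_assoc, one_div, inv_mul_cancel₀, one_mul]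
  exact_mod_cast Module.finrank_pos.ne'

theorem isTotallyUmbilical_of_isWManifold {n : ℕ} (hf : ContMDiff 𝓘(ℝ, E) 𝓘(ℝ, E') ∞ f)
    (hS : IsRestriction f S S') (hW : S'.IsWManifold n) [Nontrivial E] :
    IsTotallyUmbilical f S.g S'.g := by
  -- The difference is normal, and it is orthogonal to every normal vector, so it vanishes.
  have key : ∀ (p : M) (u v : E),
      modelSecond f S.g S'.g p u v - S.g.form p u v • modelMean f S.g S'.g p = 0 := by
    intro p u v
    refine IsNormal.eq_zero (E := E) hS (p := p) (fun w => ?_) fun N hN => ?_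
    · rw [map_sub, map_smul, sub_apply, smul_apply, form_modelSecond_tangent hf hS.g_eq,
        modelMean_isNormal hf hS, smul_zero, sub_zero]
    · rw [map_sub, map_smul, sub_apply, smul_apply, form_modelSecond_normal hf hS hW hN,
        form_modelMean_normal hf hS hW hN, smul_eq_mul, sub_self]
  exact fun p u v => sub_eq_zero.1 (key p u v)

/-- The mean curvature vector is dual to each of the three Lee forms on the normal space, up to a
non-zero factor. -/
theorem exists_form_modelMean_eq {n : ℕ} (hn : 0 < n) (hf : ContMDiff 𝓘(ℝ, E) 𝓘(ℝ, E') ∞ f)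
    (hS : IsRestriction f S S') (hW : S'.IsWManifold n) [Nontrivial E] (α : Fin 3) :
    ∃ k : ℝ, k ≠ 0 ∧ ∀ (p : M) (N : E'), IsNormal (E := E) f S'.g p N →
      S'.g.form (f p) (modelMean f S.g S'.g p) N
        = k * S'.leeForm α (f p) (modelEnd (S'.J α) (f p) N) := by
  have hn1 : (1 : ℝ) ≤ n := by exact_mod_cast hn
  have h : α = 0 ∨ α = 1 ∨ α = 2 := by fin_cases α <;> simp
  rcases h with rfl | hα
  · refine ⟨-(1 / (2 * (2 * (n : ℝ) - 1))), ?_, fun p N hN => form_modelMean_normal hf hS hW hN⟩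
    have : 0 < 2 * (2 * (n : ℝ) - 1) := by linarith
    exact neg_ne_zero.2 (one_div_pos.2 this).ne'
  · refine ⟨1 / (4 * (n : ℝ)), by positivity, fun p N hN => ?_⟩
    rw [form_modelMean_normal hf hS hW hN, normalFactor_eq hf hS hW hα hN]

theorem modelMean_ne_zero {n : ℕ} (hn : 0 < n) (hf : ContMDiff 𝓘(ℝ, E) 𝓘(ℝ, E') ∞ f)
    (hS : IsRestriction f S S') (hW : S'.IsWManifold n) [Nontrivial E] {α : Fin 3} {p : M}
    {N : E'} (hN : IsNormal (E := E) f S'.g p N) (h : S'.leeForm α (f p) N ≠ 0) :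
    modelMean f S.g S'.g p ≠ 0 := by
  obtain ⟨k, hk, hkN⟩ := exists_form_modelMean_eq hn hf hS hW α
  intro h0
  -- Evaluating at `J_α N` turns the argument of the Lee form into `J_α (J_α N) = -N`.
  have h1 := hkN p _ (hN.map_J hS α)
  have h2 : modelEnd (S'.J α) (f p) (modelEnd (S'.J α) (f p) N) = -N := S'.J_sq α (f p) N
  rw [h0, h2, S'.leeForm_neg, map_zero, zero_apply] at h1
  exact mul_ne_zero hk (neg_ne_zero.2 h) h1.symm

theorem modelMean_eq_zero {n : ℕ} (hn : 0 < n) (hf : ContMDiff 𝓘(ℝ, E) 𝓘(ℝ, E') ∞ f)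
    (hS : IsRestriction f S S') (hW : S'.IsWManifold n) [Nontrivial E] {α : Fin 3} {p : M}
    (h : ∀ N, IsNormal (E := E) f S'.g p N → S'.leeForm α (f p) N = 0) :
    modelMean f S.g S'.g p = 0 := by
  obtain ⟨k, -, hkN⟩ := exists_form_modelMean_eq hn hf hS hW α
  refine IsNormal.eq_zero (E := E) hS (modelMean_isNormal hf hS p) fun N hN => ?_
  rw [hkN p N hN, h _ (hN.map_J hS α), mul_zero]

end Umbilical

end HermitianNorden

end

/-- `M` is a holomorphic `W`-submanifold, of dimension `4m`, of the `W`-manifold `M'` of dimension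
`4n`. -/
theorem corollary3p4
    (m n : ℕ) (hm : 0 < m) (hmn : m < n)
    {E : Type*} [NormedAddCommGroup E] [NormedSpace ℝ E] [FiniteDimensional ℝ E]
    (hE : Module.finrank ℝ E = 4 * m)
    {M : Type*} [TopologicalSpace M] [T2Space M] [ChartedSpace E M] [IsManifold 𝓘(ℝ, E) ∞ M]
    {E' : Type*} [NormedAddCommGroup E'] [NormedSpace ℝ E'] [FiniteDimensional ℝ E']
    (hE' : Module.finrank ℝ E' = 4 * n)
    {M' : Type*} [TopologicalSpace M'] [T2Space M'] [ChartedSpace E' M']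
    [IsManifold 𝓘(ℝ, E') ∞ M']
    (S' : HermitianNorden.HNStructure E' M') (hS' : S'.IsWManifold n)
    (f : M → M') (hf : HermitianNorden.IsHolomorphicSubmanifold (E := E) f S')
    (S : HermitianNorden.HNStructure E M) (hSS' : HermitianNorden.IsRestriction f S S')
    (hS : S.IsWManifold m) :
    ((∀ α : Fin 3, ∃ p : M, ∃ N ∈ HermitianNorden.normalSpace (E := E) f S'.g p,
        S'.leeForm α (f p) N ≠ 0) →
      HermitianNorden.IsTotallyUmbilical f S.g S'.g ∧
      ∀ p : M, (∃ α : Fin 3, ∃ N ∈ HermitianNorden.normalSpace (E := E) f S'.g p,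
        S'.leeForm α (f p) N ≠ 0) → HermitianNorden.meanCurvature f S.g S'.g p ≠ 0) ∧
    ((∀ (α : Fin 3) (p : M), ∀ N ∈ HermitianNorden.normalSpace (E := E) f S'.g p,
        S'.leeForm α (f p) N = 0) →
      HermitianNorden.IsTotallyGeodesic f S.g S'.g) := by
  have : Nontrivial E := Module.nontrivial_of_finrank_pos (R := ℝ) (by omega)
  have hn : 0 < n := hm.trans hmn
  have hu := HermitianNorden.isTotallyUmbilical_of_isWManifold hf.contMDiff hSS' hS'
  refine ⟨fun _ => ⟨hu, ?_⟩, fun h p u v => ?_⟩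
  · rintro p ⟨α, N, hN, hα⟩
    exact HermitianNorden.modelMean_ne_zero hn hf.contMDiff hSS' hS' hN hα
  -- A single Lee form, here `θ_1`, already determines `C`.
  · have h0 : HermitianNorden.meanCurvature f S.g S'.g p = 0 :=
      HermitianNorden.modelMean_eq_zero hn hf.contMDiff hSS' hS' (fun N hN => h 0 p N hN)
    rw [hu p u v, h0, smul_zero]
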